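/- Let $k\ge 2$ be an integer and $0<\varepsilon<1$. There is $N=N(k,\varepsilon)$ such that the following holds for every $n\ge N$. Let $q$ and $t$ be integers obtained by rounding (each up or down, arbitrarily) the numbers $\frac{\varepsilon^4 n}{10^5k^2\log n}$ and $\frac{\varepsilon^7 n}{10^{11}k^5}$, respectively, where $\log$ is the natural logarithm. Let $G$ be the incomparability graph of a partial order on $n$ elements, that is, the graph on these elements in which two elements are adjacent if and only if they are incomparable. Suppose that $G$ has no (not necessarily induced) subgraph isomorphic to $K_k[q]$, the complete $k$-partite graph with all parts of size $q$. Then there are an integer $m \ge 0$ and a partition $V(G)=V_0\sqcup V_1\sqcup\dots\sqcup V_m$ such that $|V_0|\le\varepsilon n$, $|V_1|=\dots=|V_m|=t$, and all but at most $\varepsilon m^2$ of the pairs $(V_i,V_j)$ with $1\le i<j\le m$ are homogeneous, meaning that either all or none of the pairs in $V_i\times V_j$ are edges of $G$. -/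

import Mathlib

/-- `G` is the incomparability graph of some partial order on its vertex set: two vertices are
adjacent exactly when neither is below the other (so adjacent vertices are distinct). -/
def IsIncomparabilityGraph {V : Type*} (G : SimpleGraph V) : Prop :=
  ∃ P : PartialOrder V, ∀ u v : V, G.Adj u v ↔ ¬ P.le u v ∧ ¬ P.le v u

/-- A pair of vertex sets is homogeneous if the bipartite graph between them is complete or
empty. -/
def IsHomogeneousPair {V : Type*} (G : SimpleGraph V) (A B : Finset V) : Prop :=
  (∀ a ∈ A, ∀ b ∈ B, G.Adj a b) ∨ (∀ a ∈ A, ∀ b ∈ B, ¬ G.Adj a b)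

/-- The natural number `r` is obtained from the real number `x ≥ 0` by rounding it down or up. -/
def IsRounding (r : ℕ) (x : ℝ) : Prop := r = ⌊x⌋₊ ∨ r = ⌈x⌉₊

/-! Cut most of the poset into blocks of size t, each inside an interval between consecutive points
of a chain z_0 ≤ … ≤ z_L. For two such chains, a pair of blocks is inhomogeneous only where the
chains cross, and monotonicity confines this to at most 4L of the L² pairs
(`card_not_isHomogeneousPair_le`); L ≥ 4/ε makes this an ε fraction.

Such chains exist because every large set contains an interval with t of its elements
(`exists_le_card_intervalIn`): take x with many elements below it, then among these a y with many
above it. If no such x existed, disjoint 2q-sets lying below few elements would interact little, so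
k of them could be trimmed to form K_k[q]. Hence deleting few elements destroys all such sets.
Repeating this while doubling the number of dominating elements takes about log n rounds, until a
2q-set would lie below itself. -/

open Finset

/-! ### Weighted digraphs and copies of K_k[q] -/

/-- Every weighted digraph has a `g`-colouring whose monochromatic weight is at most a `1/g` fraction
of the total. -/
theorem exists_coloring_mono_weight_le {ι : Type*} [DecidableEq ι] (w : ι → ι → ℕ)
    (hw : ∀ a, w a a = 0) (g : ℕ) [NeZero g] (S : Finset ι) :
    ∃ f : ι → Fin g,
      g * ∑ a ∈ S, ∑ b ∈ S, (if f a = f b then w a b else 0) ≤ ∑ a ∈ S, ∑ b ∈ S, w a b := by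
  induction S using Finset.induction_on with
  | empty => exact ⟨fun _ => 0, by simp⟩
  | insert x S hx ih =>
    obtain ⟨f, hf⟩ := ih
    -- Greedy choice: the colour of least weight to and from `x` costs at most the average over the
    -- `g` colours.
    obtain ⟨c, -, hc⟩ := exists_min_image (univ : Finset (Fin g))
      (fun c => ∑ b ∈ S, if f b = c then w x b + w b x else 0) univ_nonempty
    have hc' : g * (∑ b ∈ S, if f b = c then w x b + w b x else 0)
        ≤ ∑ b ∈ S, (w x b + w b x) := by
      have h := card_nsmul_le_sum univ _ _ hc
      rw [sum_comm] at h
      simpa using h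
    have hne : ∀ a ∈ S, a ≠ x := fun a ha h => hx (h ▸ ha)
    refine ⟨Function.update f x c, ?_⟩
    have h1 : ∑ a ∈ S, ∑ b ∈ S,
        (if Function.update f x c a = Function.update f x c b then w a b else 0)
        = ∑ a ∈ S, ∑ b ∈ S, (if f a = f b then w a b else 0) :=
      sum_congr rfl fun a ha => sum_congr rfl fun b hb => by
        rw [Function.update_of_ne (hne a ha), Function.update_of_ne (hne b hb)]
    have h2 : ∑ b ∈ S, (if Function.update f x c x = Function.update f x c b then w x b else 0)
        = ∑ b ∈ S, (if f b = c then w x b else 0) :=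
      sum_congr rfl fun b hb => by
        rw [Function.update_of_ne (hne b hb), Function.update_self]; simp only [eq_comm]
    have h3 : ∑ a ∈ S, (if Function.update f x c a = Function.update f x c x then w a x else 0)
        = ∑ a ∈ S, (if f a = c then w a x else 0) :=
      sum_congr rfl fun b hb => by
        rw [Function.update_of_ne (hne b hb), Function.update_self]
    have h4 : ∑ b ∈ S, (if f b = c then w x b + w b x else 0)
        = ∑ b ∈ S, (if f b = c then w x b else 0) + ∑ a ∈ S, (if f a = c then w a x else 0) := by
      rw [← sum_add_distrib]
      exact sum_congr rfl fun b _ => by split_ifs <;> simp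
    rw [h4, sum_add_distrib] at hc'
    simp only [sum_insert hx, sum_add_distrib, hw, h1, h2, h3, ite_self]
    nlinarith

/-- In a weighted digraph with small out-weights there are many vertices with small mutual
in-weights. -/
theorem exists_subset_card_eq_in_weight_le {ι : Type*} [DecidableEq ι] (w : ι → ι → ℕ)
    (hw : ∀ a, w a a = 0) {g k q : ℕ} (hg : 0 < g) {S : Finset ι} (hS : 2 * g * k ≤ #S)
    (hout : ∀ a ∈ S, 2 * ∑ b ∈ S, w a b ≤ g * q) :
    ∃ T ⊆ S, #T = k ∧ ∀ b ∈ T, ∑ a ∈ T, w a b ≤ q := by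
  have : NeZero g := ⟨hg.ne'⟩
  obtain ⟨f, hf⟩ := exists_coloring_mono_weight_le w hw g S
  let M : ι → ℕ := fun b => ∑ a ∈ S, (if f a = f b then w a b else 0)
  have hmono : 2 * ∑ b ∈ S, M b ≤ #S * q := by
    have h1 : 2 * ∑ a ∈ S, ∑ b ∈ S, w a b ≤ #S * (g * q) := by
      rw [mul_sum]
      simpa using sum_le_card_nsmul S _ _ hout
    rw [sum_comm] at hf
    change g * ∑ b ∈ S, M b ≤ _ at hf
    refine le_of_mul_le_mul_left (a := g) ?_ hg
    nlinarith
  -- Markov: at most half of `S` has monochromatic in-weight above `q`. By pigeonhole, `k` of the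
  -- others share a colour, and among them all in-weight is monochromatic.
  have hbad : #{b ∈ S | ¬ M b ≤ q} * (q + 1) ≤ ∑ b ∈ S, M b := by
    refine le_trans ?_ (sum_le_sum_of_subset (filter_subset (fun b => ¬ M b ≤ q) S))
    rw [← smul_eq_mul]
    exact card_nsmul_le_sum _ _ _ fun b hb => by
      have := (mem_filter.1 hb).2
      omega
  have hcard := card_filter_add_card_filter_not (s := S) (fun b => M b ≤ q)
  have hgood : g * k ≤ #{b ∈ S | M b ≤ q} := by
    have : 2 * #{b ∈ S | ¬ M b ≤ q} ≤ #S := by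
      refine le_of_mul_le_mul_right (a := q + 1) ?_ (Nat.succ_pos q)
      nlinarith
    nlinarith
  obtain ⟨c, -, hc⟩ := exists_le_card_fiber_of_mul_le_card_of_maps_to
    (s := {b ∈ S | M b ≤ q}) (t := (univ : Finset (Fin g))) (f := f) (n := k)
    (fun _ _ => mem_univ _) univ_nonempty (by simpa using hgood)
  obtain ⟨T, hT, hTk⟩ := exists_subset_card_eq hc
  have hT' : ∀ b ∈ T, (b ∈ S ∧ M b ≤ q) ∧ f b = c := fun b hb => by simpa using hT hb
  refine ⟨T, fun b hb => (hT' b hb).1.1, hTk, fun b hb => le_trans ?_ (hT' b hb).1.2⟩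
  calc ∑ a ∈ T, w a b = ∑ a ∈ T, (if f a = f b then w a b else 0) :=
        sum_congr rfl fun a ha => by rw [if_pos ((hT' a ha).2.trans (hT' b hb).2.symm)]
    _ ≤ M b := sum_le_sum_of_subset fun a ha => (hT' a ha).1.1

/-- Disjoint large vertex sets with all edges between them give a copy of `K_k[q]`. -/
theorem not_free_completeEquipartiteGraph {V ι : Type*} {G : SimpleGraph V} {k q : ℕ}
    {T : Finset ι} (hT : #T = k) (Y : ι → Finset V) (hY : ∀ a ∈ T, q ≤ #(Y a))
    (hadj : ∀ a ∈ T, ∀ b ∈ T, a ≠ b → ∀ u ∈ Y a, ∀ v ∈ Y b, G.Adj u v) :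
    ¬ (SimpleGraph.completeEquipartiteGraph k q).Free G := by
  classical
  let e : Fin k ≃ T := (T.equivFinOfCardEq hT).symm
  have hne : ∀ i : Fin k, Nonempty (Fin q ↪ Y (e i)) := fun i =>
    Function.Embedding.nonempty_of_card_le (by simpa using hY _ (e i).2)
  let φ (i : Fin k) : Fin q ↪ Y (e i) := (hne i).some
  have key : ∀ i j : Fin k, i ≠ j → ∀ x y, G.Adj (φ i x : V) (φ j y) := fun i j hij x y =>
    hadj _ (e i).2 _ (e j).2 (fun h => hij (e.injective (Subtype.ext h))) _ (φ i x).2 _ (φ j y).2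
  refine not_not.2 ?_
  refine ⟨⟨⟨fun p => (φ p.1 p.2 : V), ?_⟩, ?_⟩⟩
  · rintro ⟨i, x⟩ ⟨j, y⟩ h
    exact key i j (by simpa [SimpleGraph.completeEquipartiteGraph] using h) x y
  · rintro ⟨i, x⟩ ⟨j, y⟩ h
    by_cases hij : i = j
    · subst hij
      have : φ i x = φ i y := Subtype.ext h
      rw [(φ i).injective this]
    · exact absurd h (key i j hij x y).ne

/-! ### Lower shadows in the absence of K_k[q] -/

section Relation

variable {V : Type*}

open scoped Classical in
/-- The elements of `U` that are `r`-below some element of `A`. -/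
noncomputable def lowerShadow (r : V → V → Prop) (U A : Finset V) : Finset V :=
  {u ∈ U | ∃ a ∈ A, r u a}

theorem mem_lowerShadow {r : V → V → Prop} {U A : Finset V} {u : V} :
    u ∈ lowerShadow r U A ↔ u ∈ U ∧ ∃ a ∈ A, r u a := by
  simp [lowerShadow]

theorem lowerShadow_subset (r : V → V → Prop) (U A : Finset V) : lowerShadow r U A ⊆ U :=
  fun _ hu => (mem_lowerShadow.1 hu).1

theorem lowerShadow_mono {r : V → V → Prop} {U U' : Finset V} (h : U ⊆ U') (A : Finset V) :
    lowerShadow r U A ⊆ lowerShadow r U' A := fun _ hu =>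
  mem_lowerShadow.2 ⟨h (mem_lowerShadow.1 hu).1, (mem_lowerShadow.1 hu).2⟩

/-- If few elements lie below each small set, then after the removal of few elements very few do. -/
theorem exists_subset_card_lowerShadow_lt {G : SimpleGraph V} {r : V → V → Prop}
    (htrans : ∀ u v w, r u v → r v w → r u w) (hG : ∀ u v, ¬ r u v → ¬ r v u → G.Adj u v)
    {k q : ℕ} (hq : 0 < q) (hfree : (SimpleGraph.completeEquipartiteGraph k q).Free G)
    {g c : ℕ} (hg : 0 < g) {U₀ U : Finset V}
    (hU : ∀ A ⊆ U₀, #A ≤ c → 2 * #(lowerShadow r U A) ≤ g * q) :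
    ∃ U' ⊆ U, #U ≤ #U' + 4 * g * k * q ∧
      ∀ A ⊆ U₀, #A ≤ c → #(lowerShadow r U' A) < 2 * q := by
  classical
  -- A maximal disjoint family of 2q-sets, each inside one shadow, is deleted. Maximality leaves no
  -- shadow of size 2q.
  let P : Finset (Finset V) → Prop := fun F =>
    (∀ X ∈ F, X ⊆ U ∧ #X = 2 * q ∧ ∃ A ⊆ U₀, #A ≤ c ∧ X ⊆ lowerShadow r U A) ∧
      (F : Set (Finset V)).PairwiseDisjoint id
  have hfin : {F | P F}.Finite := by
    refine (U.powerset.powerset.finite_toSet).subset fun F hF => ?_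
    simp only [coe_powerset, Set.mem_preimage, Set.mem_powerset_iff]
    intro X hX
    simpa using (hF.1 X hX).1
  obtain ⟨F, hF⟩ := hfin.exists_maximal ⟨∅, by simp [P]⟩
  have hdisj := hF.prop.2
  have hcardF : #(F.biUnion id) = #F * (2 * q) := by
    rw [card_biUnion hdisj]
    simpa using sum_const_nat fun X hX => (hF.prop.1 X hX).2.1
  have hsub : F.biUnion id ⊆ U := biUnion_subset.2 fun X hX => (hF.prop.1 X hX).1
  refine ⟨U \ F.biUnion id, sdiff_subset, ?_, ?_⟩
  · have hsmall : #F < 2 * g * k := by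
      by_contra! hlarge
      let w : Finset V → Finset V → ℕ := fun X Y =>
        if X = Y then 0 else #(lowerShadow r Y X)
      obtain ⟨T, hTF, hTk, hT⟩ := exists_subset_card_eq_in_weight_le w (by simp [w]) hg hlarge
        (q := q) (by
          intro X hX
          obtain ⟨-, -, A, hA, hAc, hXA⟩ := hF.prop.1 X hX
          -- By transitivity, whatever lies below `X` lies below `A`, so disjointness bounds the
          -- out-weight of `X` by one shadow.
          refine le_trans (Nat.mul_le_mul_left 2 ?_) (hU A hA hAc)
          calc ∑ Y ∈ F, w X Y ≤ ∑ Y ∈ F, #(lowerShadow r Y X) :=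
                sum_le_sum fun Y _ => by simp only [w]; split_ifs <;> simp
            _ = #(F.biUnion fun Y => lowerShadow r Y X) := by
                rw [card_biUnion]
                exact fun Y hY Z hZ hYZ => (hdisj hY hZ hYZ).mono
                  (lowerShadow_subset r Y X) (lowerShadow_subset r Z X)
            _ ≤ #(lowerShadow r U A) := card_le_card <| biUnion_subset.2 fun Y hY v hv => by
                obtain ⟨hvY, x, hx, hvx⟩ := mem_lowerShadow.1 hv
                obtain ⟨-, a, ha, hxa⟩ := mem_lowerShadow.1 (hXA hx)
                exact mem_lowerShadow.2
                  ⟨(hF.prop.1 Y hY).1 hvY, a, ha, htrans _ _ _ hvx hxa⟩)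
      refine not_free_completeEquipartiteGraph hTk
        -- Dropping from `X` what lies below the other chosen sets costs at most `q` of its 2q
        -- elements and leaves only incomparable pairs across sets.
        (fun X => X \ (T.erase X).biUnion fun Y => lowerShadow r X Y) ?_ ?_ hfree
      · intro X hX
        have h1 : #((T.erase X).biUnion fun Y => lowerShadow r X Y) ≤ q := by
          refine card_biUnion_le.trans (le_trans ?_ (hT X hX))
          refine le_trans (sum_le_sum fun Y hY => ?_)
            (sum_le_sum_of_subset (f := fun Y => w Y X) (erase_subset X T))
          simp [w, ne_of_mem_erase hY]
        have h2 := le_card_sdiff ((T.erase X).biUnion fun Y => lowerShadow r X Y) X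
        rw [(hF.prop.1 X (hTF hX)).2.1] at h2
        omega
      · have key : ∀ X ∈ T, ∀ Y ∈ T, X ≠ Y →
            ∀ u ∈ X \ (T.erase X).biUnion (fun Y => lowerShadow r X Y), ∀ v ∈ Y, ¬ r u v := by
          intro X _ Y hY hXY u hu v hv huv
          rw [mem_sdiff] at hu
          exact hu.2 (mem_biUnion.2
            ⟨Y, mem_erase.2 ⟨hXY.symm, hY⟩, mem_lowerShadow.2 ⟨hu.1, v, hv, huv⟩⟩)
        intro X hX Y hY hXY u hu v hv
        exact hG u v (key X hX Y hY hXY u hu v (mem_sdiff.1 hv).1)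
          (key Y hY X hX hXY.symm v hv u (mem_sdiff.1 hu).1)
    rw [card_sdiff_of_subset hsub, hcardF]
    have : #F * (2 * q) ≤ 2 * g * k * (2 * q) := Nat.mul_le_mul_right _ hsmall.le
    have h4 : 2 * g * k * (2 * q) = 4 * g * k * q := by ring
    omega
  · intro A hA hAc
    by_contra! hlarge
    obtain ⟨X, hX, hXq⟩ := exists_subset_card_eq hlarge
    have hXU : X ⊆ U \ F.biUnion id := hX.trans (lowerShadow_subset _ _ _)
    have hXF : ∀ Y ∈ F, Disjoint X Y := fun Y hY => disjoint_left.2 fun v hvX hvY =>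
      (mem_sdiff.1 (hXU hvX)).2 (mem_biUnion.2 ⟨Y, hY, hvY⟩)
    have hP : P (insert X F) := by
      refine ⟨?_, ?_⟩
      · intro Y hY
        rcases mem_insert.1 hY with rfl | hY
        · exact ⟨hXU.trans sdiff_subset, hXq, A, hA, hAc,
            hX.trans (lowerShadow_mono sdiff_subset A)⟩
        · exact hF.prop.1 Y hY
      · rw [coe_insert]
        exact hdisj.insert fun Y hY _ => hXF Y hY
    have hmem : X ∈ F := hF.le_of_ge hP (subset_insert X F) (mem_insert_self X F)
    have := hXF X hmem
    rw [disjoint_self_iff_empty] at this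
    subst this
    simp at hXq
    omega

/-- A set in which each element has few elements below it is small. -/
theorem card_le_of_card_lowerShadow_lt {G : SimpleGraph V} {r : V → V → Prop}
    (hrefl : ∀ u, r u u) (htrans : ∀ u v w, r u v → r v w → r u w)
    (hG : ∀ u v, ¬ r u v → ¬ r v u → G.Adj u v)
    {k q : ℕ} (hq : 0 < q) (hfree : (SimpleGraph.completeEquipartiteGraph k q).Free G)
    {J : ℕ} (hJ : 2 * q ≤ 2 ^ J) {U₀ U : Finset V} (hU₀ : U ⊆ U₀)
    (hU : ∀ A ⊆ U₀, #A ≤ 1 → #(lowerShadow r U A) < 2 * q) :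
    #U ≤ (32 * k * J + 2) * q := by
  classical
  have step : ∀ j : ℕ, ∃ U' ⊆ U, #U ≤ #U' + 32 * k * j * q ∧
      ∀ A ⊆ U₀, #A ≤ 2 ^ j → #(lowerShadow r U' A) < 2 * q := by
    intro j
    induction j with
    | zero => exact ⟨U, Subset.rfl, by simp, by simpa using hU⟩
    | succ j ih =>
      obtain ⟨U', hU', hcard, hsh⟩ := ih
      -- Splitting `A` into halves bounds its shadow by 4q, whence `g = 8`.
      obtain ⟨U'', hU'', hcard', hsh'⟩ := exists_subset_card_lowerShadow_lt (U₀ := U₀) (U := U')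
        (g := 8) (c := 2 ^ (j + 1)) htrans hG hq hfree (by norm_num) (by
          intro A hA hAc
          obtain ⟨B, hBA, hB⟩ := exists_subset_card_eq (s := A) (n := #A / 2) (by omega)
          have hAB : #(A \ B) = #A - #A / 2 := by rw [card_sdiff_of_subset hBA, hB]
          rw [pow_succ] at hAc
          have h1 := hsh B (hBA.trans hA) (by omega)
          have h2 := hsh (A \ B) (sdiff_subset.trans hA) (by omega)
          have h3 : lowerShadow r U' A ⊆ lowerShadow r U' B ∪ lowerShadow r U' (A \ B) := by
            intro u hu
            obtain ⟨huU, a, ha, hua⟩ := mem_lowerShadow.1 hu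
            by_cases haB : a ∈ B
            · exact mem_union_left _ (mem_lowerShadow.2 ⟨huU, a, haB, hua⟩)
            · exact mem_union_right _ (mem_lowerShadow.2 ⟨huU, a, mem_sdiff.2 ⟨ha, haB⟩, hua⟩)
          have h4 := (card_le_card h3).trans (card_union_le _ _)
          omega)
      refine ⟨U'', hU''.trans hU', ?_, hsh'⟩
      have : 32 * k * (j + 1) * q = 32 * k * j * q + 4 * 8 * k * q := by ring
      omega
  obtain ⟨U', hU', hcard, hsh⟩ := step J
  -- By reflexivity a 2q-set lies in its own shadow, and it has at most 2^J elements.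
  have hlt : #U' < 2 * q := by
    by_contra! h
    obtain ⟨A, hA, hAq⟩ := exists_subset_card_eq h
    have h1 := hsh A (hA.trans (hU'.trans hU₀)) (by omega)
    have h2 : A ⊆ lowerShadow r U' A := fun a ha =>
      mem_lowerShadow.2 ⟨hA ha, a, ha, hrefl a⟩
    have := card_le_card h2
    omega
  nlinarith

/-- A large set has an element with many elements of the set below it. -/
theorem exists_lt_card_lowerShadow_singleton {G : SimpleGraph V} {r : V → V → Prop}
    (hrefl : ∀ u, r u u) (htrans : ∀ u v w, r u v → r v w → r u w)
    (hG : ∀ u v, ¬ r u v → ¬ r v u → G.Adj u v)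
    {k q : ℕ} (hq : 0 < q) (hfree : (SimpleGraph.completeEquipartiteGraph k q).Free G)
    {J : ℕ} (hJ : 2 * q ≤ 2 ^ J) {g : ℕ} (hg : 0 < g) {U : Finset V}
    (hU : (32 * k * J + 2 + 4 * g * k) * q < #U) :
    ∃ x ∈ U, g * q < 2 * #(lowerShadow r U {x}) := by
  by_contra! hcon
  obtain ⟨U', hU', hcard, hsh⟩ := exists_subset_card_lowerShadow_lt (U₀ := U) (U := U)
    (g := g) (c := 1) htrans hG hq hfree hg (by
      intro A hA hA1
      rcases A.eq_empty_or_nonempty with rfl | hne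
      · simp [lowerShadow]
      · obtain ⟨x, rfl⟩ := card_eq_one.1 (le_antisymm hA1 hne.card_pos)
        exact hcon x (by simpa using hA))
  have := card_le_of_card_lowerShadow_lt hrefl htrans hG hq hfree hJ hU' hsh
  nlinarith

end Relation

/-! ### Chains of populous intervals -/

/-- If every subset of `U` with more than `H` elements contains an `R`-related pair, then a large set
contains a long `R`-chain. -/
theorem exists_chain_of_mul_lt_card {V : Type*} {R : V → V → Prop} {H : ℕ} (L : ℕ) (U : Finset V)
    (hR : ∀ T ⊆ U, H < #T → ∃ y ∈ T, ∃ x ∈ T, R y x) (hU : L * H < #U) :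
    ∃ z : ℕ → V, (∀ i ≤ L, z i ∈ U) ∧ ∀ i < L, R (z i) (z (i + 1)) := by
  classical
  induction L generalizing U with
  | zero =>
    obtain ⟨x, hx⟩ := card_pos.1 (by omega : 0 < #U)
    exact ⟨fun _ => x, fun _ _ => hx, fun i hi => absurd hi (Nat.not_lt_zero i)⟩
  | succ L ih =>
    -- Elements without a predecessor contain no related pair. A chain among the rest can be
    -- extended at its bottom.
    have hmin : #{x ∈ U | ¬ ∃ y ∈ U, R y x} ≤ H := by
      refine not_lt.1 fun h => ?_
      obtain ⟨y, hy, x, hx, hyx⟩ := hR _ (filter_subset _ _) h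
      exact (mem_filter.1 hx).2 ⟨y, (mem_filter.1 hy).1, hyx⟩
    have hcard := card_filter_add_card_filter_not (s := U) (fun x => ∃ y ∈ U, R y x)
    obtain ⟨z, hzU, hz⟩ := ih {x ∈ U | ∃ y ∈ U, R y x}
      (fun T hT => hR T (hT.trans (filter_subset _ _))) (by
        rw [Nat.succ_mul] at hU
        omega)
    obtain ⟨hz0, y, hy, hyz⟩ := mem_filter.1 (hzU 0 (Nat.zero_le L))
    refine ⟨fun i => Nat.casesOn i y z, ?_, ?_⟩
    · rintro (_ | i) hi
      · exact hy
      · exact (mem_filter.1 (hzU i (by omega))).1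
    · rintro (_ | i) hi
      · exact hyz
      · exact hz i (by omega)

section Poset

variable {V : Type*} [PartialOrder V]

open scoped Classical in
/-- The elements of `U` in the half-open order interval from `y` to `x`. -/
noncomputable def intervalIn (U : Finset V) (y x : V) : Finset V := {v ∈ U | y ≤ v ∧ v < x}

theorem mem_intervalIn {U : Finset V} {y x v : V} :
    v ∈ intervalIn U y x ↔ v ∈ U ∧ y ≤ v ∧ v < x := by
  simp [intervalIn]

/-- In a poset whose incomparability graph has no `K_k[q]`, every large set contains the endpoints
of an interval with many elements of the set. -/
theorem exists_le_card_intervalIn {G : SimpleGraph V}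
    (hG : ∀ u v : V, G.Adj u v ↔ ¬ u ≤ v ∧ ¬ v ≤ u) {k q : ℕ} (hk : 0 < k) (hq : 0 < q)
    (hfree : (SimpleGraph.completeEquipartiteGraph k q).Free G)
    {J : ℕ} (hJ : 2 * q ≤ 2 ^ J) {g t : ℕ} (hg : 0 < g) (hgt : 2 * t ≤ g * q) {U : Finset V}
    (hU : (32 * k * J + 2 + 4 * (2 * (32 * k * J + 2 + 4 * g * k)) * k) * q < #U) :
    ∃ y ∈ U, ∃ x ∈ U, t ≤ #(intervalIn U y x) := by
  classical
  -- Here `g` is twice the coefficient needed for the second application, which uses the dual order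
  -- inside the shadow of `x`.
  obtain ⟨x, hx, hD⟩ := exists_lt_card_lowerShadow_singleton (G := G) (r := (· ≤ ·)) (U := U)
    (fun _ => le_rfl) (fun _ _ _ => le_trans) (fun u v h1 h2 => (hG u v).2 ⟨h1, h2⟩) hq hfree hJ
    (by positivity) hU
  obtain ⟨y, hy, hE⟩ := exists_lt_card_lowerShadow_singleton (G := G) (r := (· ≥ ·))
    (U := lowerShadow (· ≤ ·) U {x})
    (fun _ => le_rfl) (fun _ _ _ h1 h2 => le_trans h2 h1) (fun u v h1 h2 => (hG u v).2 ⟨h2, h1⟩)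
    hq hfree hJ hg (by rw [mul_assoc] at hD; omega)
  refine ⟨y, (mem_lowerShadow.1 hy).1, x, hx, ?_⟩
  -- The interval omits `x`; the strict bound on the shadow pays for this one element.
  have hsub : (lowerShadow (· ≥ ·) (lowerShadow (· ≤ ·) U {x}) {y}).erase x ⊆
      intervalIn U y x := by
    intro v hv
    obtain ⟨hvx, hv⟩ := mem_erase.1 hv
    simp only [mem_lowerShadow, mem_singleton, exists_eq_left] at hv
    exact mem_intervalIn.2 ⟨hv.1.1, hv.2, lt_of_le_of_ne hv.1.2 hvx⟩
  have h1 := card_le_card hsub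
  have h2 := pred_card_le_card_erase (s := lowerShadow (· ≥ ·) (lowerShadow (· ≤ ·) U {x}) {y})
    (a := x)
  omega

/-- A greedy decomposition of a finite set into chains of consecutive blocks. -/
theorem exists_chains_of_blocks {H L t : ℕ} (hL : 0 < L) (ht : 0 < t) (U : Finset V)
    (hU : ∀ T ⊆ U, H < #T → ∃ y ∈ T, ∃ x ∈ T, t ≤ #(intervalIn T y x)) :
    ∃ (K : ℕ) (z : Fin K → ℕ → V) (B : Fin K × Fin L → Finset V) (R : Finset V),
      (∀ c, ∀ i ≤ L, ∀ j ≤ L, i ≤ j → z c i ≤ z c j) ∧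
      (∀ p, #(B p) = t ∧ B p ⊆ U ∧ ∀ v ∈ B p, z p.1 p.2 ≤ v ∧ v ≤ z p.1 (p.2 + 1)) ∧
      (∀ p p', p ≠ p' → Disjoint (B p) (B p')) ∧
      (∀ p, Disjoint R (B p)) ∧ R ⊆ U ∧ (∀ u ∈ U, u ∈ R ∨ ∃ p, u ∈ B p) ∧ #R ≤ L * H := by
  classical
  induction hn : #U using Nat.strong_induction_on generalizing U with
  | _ n ih =>
  by_cases hsmall : #U ≤ L * H
  · exact ⟨0, fun c => c.elim0, fun p => p.1.elim0, U, fun c => c.elim0, fun p => p.1.elim0,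
      fun p => p.1.elim0, fun p => p.1.elim0, Subset.rfl, fun u hu => Or.inl hu, hsmall⟩
  obtain ⟨z, -, hz⟩ := exists_chain_of_mul_lt_card (R := fun y x => t ≤ #(intervalIn U y x)) L U
    (fun T hT hTH => by
      obtain ⟨y, hy, x, hx, h⟩ := hU T hT hTH
      refine ⟨y, hy, x, hx, h.trans (card_le_card fun v hv => ?_)⟩
      rw [mem_intervalIn] at hv ⊢
      exact ⟨hT hv.1, hv.2⟩) (by omega)
  have hstep : ∀ i < L, z i ≤ z (i + 1) := fun i hi => by
    obtain ⟨v, hv⟩ := card_pos.1 (ht.trans_le (hz i hi))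
    have := (mem_intervalIn.1 hv).2
    exact this.1.trans this.2.le
  have hmono : ∀ i ≤ L, ∀ j ≤ L, i ≤ j → z i ≤ z j := by
    intro i _ j hj hij
    induction j, hij using Nat.le_induction with
    | base => exact le_rfl
    | succ j _ ihj => exact (ihj (by omega)).trans (hstep j (by omega))
  choose B₀ hB₀ hB₀t using fun i : Fin L => exists_subset_card_eq (hz i i.2)
  have hB₀mem : ∀ i, ∀ v ∈ B₀ i, v ∈ U ∧ z i ≤ v ∧ v < z (i + 1) := fun i v hv =>
    mem_intervalIn.1 (hB₀ i hv)
  -- Half-open intervals keep consecutive blocks disjoint.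
  have hlt : ∀ i j : Fin L, i < j → Disjoint (B₀ i) (B₀ j) := fun i j hij =>
    disjoint_left.2 fun v hvi hvj =>
      absurd ((hB₀mem i v hvi).2.2.trans_le
        ((hmono _ (by omega) _ (by omega) (by simpa using hij)).trans (hB₀mem j v hvj).2.1))
        (lt_irrefl v)
  have hB₀disj : ∀ i j : Fin L, i ≠ j → Disjoint (B₀ i) (B₀ j) := fun i j hij =>
    (lt_or_gt_of_ne hij).elim (hlt i j) fun h => (hlt j i h).symm
  have hU' : #(U \ univ.biUnion B₀) < n := by
    rw [← hn]
    obtain ⟨v, hv⟩ := card_pos.1 (by rw [hB₀t ⟨0, hL⟩]; exact ht)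
    refine card_lt_card (ssubset_iff_of_subset sdiff_subset |>.2
      ⟨v, (hB₀mem _ v hv).1, fun h => ?_⟩)
    exact (mem_sdiff.1 h).2 (mem_biUnion.2 ⟨_, mem_univ _, hv⟩)
  obtain ⟨K, z', B, R, h1, h2, h3, h4, h5, h6, h7⟩ := ih _ hU' (U \ univ.biUnion B₀)
    (fun T hT => hU T (hT.trans sdiff_subset)) rfl
  have hsep : ∀ S ⊆ U \ univ.biUnion B₀, ∀ i, Disjoint S (B₀ i) := fun S hS i =>
    disjoint_left.2 fun v hv hvi => (mem_sdiff.1 (hS hv)).2 (mem_biUnion.2 ⟨i, mem_univ i, hvi⟩)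
  refine ⟨K + 1, Fin.cons z z',
    fun p => Fin.cases (motive := fun _ => Finset V) (B₀ p.2) (fun c => B (c, p.2)) p.1, R,
    ?_, ?_, ?_, ?_, h5.trans sdiff_subset, ?_, h7⟩
  · exact fun c => Fin.cases hmono h1 c
  · rintro ⟨c, i⟩
    refine Fin.cases ?_ (fun c => ?_) c
    · exact ⟨hB₀t i, fun v hv => (hB₀mem i v hv).1,
        fun v hv => ⟨(hB₀mem i v hv).2.1, (hB₀mem i v hv).2.2.le⟩⟩
    · exact ⟨(h2 (c, i)).1, (h2 (c, i)).2.1.trans sdiff_subset, (h2 (c, i)).2.2⟩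
  · rintro ⟨c, i⟩ ⟨c', j⟩
    refine Fin.cases ?_ (fun c => ?_) c <;> refine Fin.cases ?_ (fun c' => ?_) c'
    · exact fun h => hB₀disj i j fun hij => h (by rw [hij])
    · exact fun _ => (hsep _ (h2 (c', j)).2.1 i).symm
    · exact fun _ => hsep _ (h2 (c, i)).2.1 j
    · exact fun h => h3 (c, i) (c', j) fun he => h (by
        rw [Prod.mk.injEq] at he
        rw [he.1, he.2])
  · rintro ⟨c, i⟩
    exact Fin.cases (hsep R h5 i) (fun c => h4 (c, i)) c
  · intro u hu
    by_cases huB : u ∈ univ.biUnion B₀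
    · obtain ⟨i, -, hi⟩ := mem_biUnion.1 huB
      exact Or.inr ⟨(0, i), hi⟩
    · rcases h6 u (mem_sdiff.2 ⟨hu, huB⟩) with h | ⟨p, hp⟩
      · exact Or.inl h
      · exact Or.inr ⟨(p.1.succ, p.2), hp⟩

/-! ### Crossings and inhomogeneous pairs -/

/-- Two families of chains cross in few places. -/
theorem card_crossing_le {K L : ℕ} (z : Fin K → ℕ → V)
    (hz : ∀ c, ∀ i ≤ L, ∀ j ≤ L, i ≤ j → z c i ≤ z c j)
    (S : Finset ((Fin K × Fin L) × (Fin K × Fin L)))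
    (hS : ∀ p ∈ S, z p.1.1 p.1.2 ≤ z p.2.1 (p.2.2 + 1) ∧ ¬ z p.1.1 (p.1.2 + 1) ≤ z p.2.1 p.2.2) :
    #S ≤ K * K * (2 * L) := by
  have hcard : #((univ : Finset (Fin K × Fin K)) ×ˢ range (2 * L)) = K * K * (2 * L) := by simp
  rw [← hcard]
  refine card_le_card_of_injOn (fun p => ((p.1.1, p.2.1), (p.1.2 + p.2.2 : ℕ))) ?_ ?_
  · rintro ⟨⟨c, i⟩, ⟨c', j⟩⟩ -
    simp only [coe_product, coe_univ, Set.mem_prod, Set.mem_univ, true_and, coe_range, Set.mem_Iio]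
    omega
  -- Each antidiagonal has at most one crossing: `i < i'` forces `j' < j`, so z_{i+1} ≤ z_{i'} ≤
  -- z'_{j'+1} ≤ z'_j.
  · have key : ∀ c c' (i j i' j' : Fin L), ((c, i), (c', j)) ∈ S → ((c, i'), (c', j')) ∈ S →
        (i + j : ℕ) = i' + j' → ¬ i < i' := by
      intro c c' i j i' j' h h' hsum hlt
      refine (hS _ h).2 ?_
      have hlt' : (i : ℕ) < i' := hlt
      exact (hz c (i + 1) (by omega) i' (by omega) (by omega)).trans
        ((hS _ h').1.trans (hz c' (j' + 1) (by omega) j (by omega) (by omega)))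
    rintro ⟨⟨c, i⟩, ⟨c', j⟩⟩ hp ⟨⟨d, i'⟩, ⟨d', j'⟩⟩ hp' heq
    simp only [Prod.mk.injEq] at heq
    obtain ⟨⟨rfl, rfl⟩, hsum⟩ := heq
    have h1 := key _ _ _ _ _ _ hp hp' hsum
    have h2 := key _ _ _ _ _ _ hp' hp hsum.symm
    have hi : i = i' := le_antisymm (not_lt.1 h2) (not_lt.1 h1)
    subst hi
    have hj : j = j' := Fin.ext (by omega)
    rw [hj]

open scoped Classical in
/-- Few pairs of blocks of chains are inhomogeneous in the incomparability graph. -/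
theorem card_not_isHomogeneousPair_le {G : SimpleGraph V}
    (hG : ∀ u v : V, G.Adj u v ↔ ¬ u ≤ v ∧ ¬ v ≤ u) {K L : ℕ} (z : Fin K → ℕ → V)
    (hz : ∀ c, ∀ i ≤ L, ∀ j ≤ L, i ≤ j → z c i ≤ z c j) (B : Fin K × Fin L → Finset V)
    (hB : ∀ p, ∀ v ∈ B p, z p.1 p.2 ≤ v ∧ v ≤ z p.1 (p.2 + 1)) :
    #{p : (Fin K × Fin L) × (Fin K × Fin L) | ¬ IsHomogeneousPair G (B p.1) (B p.2)}
      ≤ K * K * (4 * L) := by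
  let C : (Fin K × Fin L) × (Fin K × Fin L) → Prop := fun p =>
    z p.1.1 p.1.2 ≤ z p.2.1 (p.2.2 + 1) ∧ ¬ z p.1.1 (p.1.2 + 1) ≤ z p.2.1 p.2.2
  have h1 : #{p | C p} ≤ K * K * (2 * L) :=
    card_crossing_le z hz _ fun p hp => (mem_filter.1 hp).2
  have h2 : #{p | C (Prod.swap p)} ≤ K * K * (2 * L) := by
    rw [← card_map (Equiv.prodComm _ _).toEmbedding]
    refine card_crossing_le z hz _ fun p hp => ?_
    obtain ⟨p', hp', rfl⟩ := mem_map.1 hp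
    exact (mem_filter.1 hp').2
  have h3 : ({p | ¬ IsHomogeneousPair G (B p.1) (B p.2)} :
      Finset ((Fin K × Fin L) × (Fin K × Fin L))) ⊆
      ({p | C p} : Finset _) ∪ ({p | C (Prod.swap p)} : Finset _) := by
    rintro ⟨p, p'⟩ hp
    have hp := (mem_filter.1 hp).2
    simp only [IsHomogeneousPair, not_or, not_forall, not_not] at hp
    obtain ⟨⟨a', ha', b', hb', hab'⟩, a, ha, b, hb, hab⟩ := hp
    rw [hG] at hab hab'
    simp only [mem_union, mem_filter_univ, C, Prod.swap]
    -- The comparable pair relates the outer endpoints; the incomparable pair prevents the inner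
    -- ones from being related.
    rcases (by tauto : a' ≤ b' ∨ b' ≤ a') with h | h
    · exact Or.inl ⟨(hB p a' ha').1.trans (h.trans (hB p' b' hb').2),
        fun hle => hab.1 ((hB p a ha).2.trans (hle.trans (hB p' b hb).1))⟩
    · exact Or.inr ⟨(hB p' b' hb').1.trans (h.trans (hB p a' ha').2),
        fun hle => hab.2 ((hB p' b hb).2.trans (hle.trans (hB p a ha).1))⟩
  have h4 := (card_le_card h3).trans (card_union_le _ _)
  have h5 : K * K * (4 * L) = K * K * (2 * L) + K * K * (2 * L) := by ring
  omega

end Poset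

/-! ### Numerical estimates -/

/-- Rounding a number that is at least `1` gives a positive integer at most twice as large. -/
theorem IsRounding.bounds {r : ℕ} {x : ℝ} (h : IsRounding r x) (hx : 1 ≤ x) :
    0 < r ∧ (r : ℝ) ≤ 2 * x := by
  rcases h with rfl | rfl
  · exact ⟨Nat.floor_pos.2 hx, (Nat.floor_le (by linarith)).trans (by linarith)⟩
  · exact ⟨Nat.ceil_pos.2 (by linarith), (Nat.ceil_lt_add_one (by linarith)).le.trans (by linarith)⟩

/-- For large `n` both part sizes are at least `1` before rounding. -/
theorem exists_forall_one_le_part_sizes (k : ℕ) (hk : 2 ≤ k) (ε : ℝ) (hε0 : 0 < ε) :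
    ∃ N : ℕ, ∀ n : ℕ, N ≤ n → 2 ≤ Real.log n ∧
      1 ≤ ε ^ 4 * n / (10 ^ 5 * k ^ 2 * Real.log n) ∧ 1 ≤ ε ^ 7 * n / (10 ^ 11 * k ^ 5) := by
  have hk0 : (0 : ℝ) < k := by exact_mod_cast (by omega : 0 < k)
  have hlog := (Real.tendsto_log_atTop.comp tendsto_natCast_atTop_atTop).eventually_ge_atTop 2
  have hcast := tendsto_natCast_atTop_atTop (R := ℝ)
  have hc : 0 < ε ^ 4 / (10 ^ 5 * k ^ 2 : ℝ) := by positivity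
  have ho := (Real.isLittleO_log_id_atTop.comp_tendsto hcast).bound hc
  have ht := hcast.eventually_ge_atTop (10 ^ 11 * k ^ 5 / ε ^ 7)
  obtain ⟨N, hN⟩ := Filter.eventually_atTop.1 (hlog.and (ho.and ht))
  refine ⟨N, fun n hn => ?_⟩
  obtain ⟨h1, h2, h3⟩ := hN n hn
  simp only [Function.comp_apply, id, Real.norm_eq_abs, Nat.abs_cast] at h1 h2
  rw [abs_of_nonneg (by linarith)] at h2
  refine ⟨h1, ?_, ?_⟩
  · rw [le_div_iff₀ (by positivity)]
    rw [div_mul_eq_mul_div, le_div_iff₀ (by positivity)] at h2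
    linarith
  · rw [le_div_iff₀ (by positivity)]
    rw [div_le_iff₀ (by positivity)] at h3
    linarith

/-- For these part sizes, the vertices left over by the greedy decomposition are at most `ε * n`. -/
theorem exists_chain_length_mul_bound_le {k : ℕ} (hk : 2 ≤ k) {ε : ℝ} (hε0 : 0 < ε) (hε1 : ε < 1)
    {n q t : ℕ} (hlog : 2 ≤ Real.log n) (hq0 : 0 < q)
    (hq : (q : ℝ) ≤ 2 * (ε ^ 4 * n / (10 ^ 5 * k ^ 2 * Real.log n)))
    (ht : (t : ℝ) ≤ 2 * (ε ^ 7 * n / (10 ^ 11 * k ^ 5))) :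
    ∃ J g : ℕ, 2 * q ≤ 2 ^ J ∧ 0 < g ∧ 2 * t ≤ g * q ∧
      ((⌈4 / ε⌉₊ * ((32 * k * J + 2 + 4 * (2 * (32 * k * J + 2 + 4 * g * k)) * k) * q) : ℕ) : ℝ)
        ≤ ε * n := by
  set ℓ := Real.log n with hℓ
  have hk2 : (2 : ℝ) ≤ k := by exact_mod_cast hk
  have hn0 : (0 : ℝ) ≤ n := n.cast_nonneg
  have hq1 : (1 : ℝ) ≤ q := by exact_mod_cast hq0
  have hqk : (k : ℝ) ^ 2 * ℓ * q ≤ 2 * ε ^ 4 * n / 10 ^ 5 := by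
    calc (k : ℝ) ^ 2 * ℓ * q
        ≤ k ^ 2 * ℓ * (2 * (ε ^ 4 * n / (10 ^ 5 * k ^ 2 * ℓ))) := by gcongr
      _ = 2 * ε ^ 4 * n / 10 ^ 5 := by
        have : ℓ ≠ 0 := by linarith
        field_simp
  have htk : (k : ℝ) ^ 2 * t ≤ 2 * ε ^ 4 * n / 10 ^ 11 := by
    calc (k : ℝ) ^ 2 * t ≤ k ^ 2 * (2 * (ε ^ 7 * n / (10 ^ 11 * k ^ 5))) := by gcongr
      _ = 2 * (ε ^ 4 * ε ^ 3) * n / 10 ^ 11 * (1 / k ^ 3) := by field_simp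
      _ ≤ 2 * (ε ^ 4 * 1) * n / 10 ^ 11 * 1 := by
        gcongr
        · exact pow_le_one₀ hε0.le hε1.le
        · rw [div_le_one (by positivity)]
          exact one_le_pow₀ (by linarith)
      _ = 2 * ε ^ 4 * n / 10 ^ 11 := by ring
  have hε42 : ε ^ 4 ≤ ε ^ 2 := pow_le_pow_of_le_one hε0.le hε1.le (by norm_num)
  have hε2 : ε ^ 2 ≤ 1 := pow_le_one₀ hε0.le hε1.le
  have hεn : ε ^ 4 * n ≤ ε ^ 2 * n := by gcongr
  have hεn' : ε ^ 2 * n ≤ n := by nlinarith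
  have h2q : (2 * q : ℝ) ≤ n := by
    have : (8 : ℝ) ≤ k ^ 2 * ℓ := by nlinarith
    have : (8 : ℝ) * q ≤ k ^ 2 * ℓ * q := by gcongr
    nlinarith
  obtain ⟨J, hJ, hJℓ⟩ : ∃ J : ℕ, 2 * q ≤ 2 ^ J ∧ (J : ℝ) ≤ 2 * ℓ := by
    refine ⟨Nat.log 2 (2 * q) + 1, (Nat.lt_pow_succ_log_self (by norm_num) _).le, ?_⟩
    have h1 : 2 ^ Nat.log 2 (2 * q) ≤ 2 * q := Nat.pow_log_le_self 2 (by omega)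
    have h2 : ((2 : ℝ)) ^ Nat.log 2 (2 * q) ≤ n := le_trans (by exact_mod_cast h1) h2q
    have h3 := Real.log_le_log (by positivity) h2
    rw [Real.log_pow] at h3
    have h4 := Real.log_two_gt_d9
    have h5 : (0 : ℝ) ≤ Nat.log 2 (2 * q) := Nat.cast_nonneg _
    push_cast
    nlinarith
  -- This `g` exceeds 2t/q by at most one, so `g * q` is at most 2t + q.
  refine ⟨J, 2 * t / q + 1, hJ, Nat.succ_pos _, ?_, ?_⟩
  · rw [add_mul, one_mul]
    have := Nat.div_add_mod' (2 * t) q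
    have := Nat.mod_lt (2 * t) hq0
    omega
  have hgq : (((2 * t / q + 1 : ℕ) : ℝ)) * q ≤ 2 * t + q := by
    have := Nat.div_mul_le_self (2 * t) q
    have : (2 * t / q + 1) * q ≤ 2 * t + q := by rw [add_mul, one_mul]; omega
    exact_mod_cast this
  set g := 2 * t / q + 1
  have hH : ((32 * k * J + 2 + 4 * (2 * (32 * k * J + 2 + 4 * g * k)) * k : ℝ)) * q
      ≤ ε ^ 2 * n / 50 := by
    have h1 : (32 * k * J + 2 : ℝ) ≤ 65 * (k * ℓ) := by nlinarith
    calc ((32 * k * J + 2 + 4 * (2 * (32 * k * J + 2 + 4 * g * k)) * k : ℝ)) * q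
        = (32 * k * J + 2) * (1 + 8 * k) * q + 32 * k ^ 2 * (g * q) := by ring
      _ ≤ 65 * (k * ℓ) * (9 * k) * q + 32 * k ^ 2 * (2 * t + q) := by
        gcongr
        linarith
      _ = 585 * (k ^ 2 * ℓ * q) + 64 * (k ^ 2 * t) + 16 * (k ^ 2 * 2 * q) := by ring
      _ ≤ 585 * (k ^ 2 * ℓ * q) + 64 * (k ^ 2 * t) + 16 * (k ^ 2 * ℓ * q) := by gcongr
      _ ≤ ε ^ 2 * n / 50 := by linarith [mul_nonneg (sq_nonneg ε) hn0]
  have hL : (⌈4 / ε⌉₊ : ℝ) ≤ 5 / ε := by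
    have h1 := (Nat.ceil_lt_add_one (show (0 : ℝ) ≤ 4 / ε by positivity)).le
    have h2 : 1 ≤ 1 / ε := by rw [le_div_iff₀ hε0]; linarith
    have h3 : 5 / ε = 4 / ε + 1 / ε := by ring
    linarith
  push_cast
  calc (⌈4 / ε⌉₊ : ℝ) * ((32 * k * J + 2 + 4 * (2 * (32 * k * J + 2 + 4 * g * k)) * k) * q)
      ≤ 5 / ε * (ε ^ 2 * n / 50) := by gcongr
    _ = ε * n / 10 := by field_simp; ring
    _ ≤ ε * n := by nlinarith [mul_nonneg hε0.le hn0]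

-- Assembling the partition

/- `SimpleGraph.completeEquipartiteGraph k q` is the blowup `K_k[q]`, and `H.Free G` says that `G`
has no (not necessarily induced) subgraph isomorphic to `H`. The parts are `W 0, …, W m`, with
`W 0` the exceptional one. -/
theorem theorem1p8 (k : ℕ) (hk : 2 ≤ k) (ε : ℝ) (hε0 : 0 < ε) (hε1 : ε < 1) :
    ∃ N : ℕ, ∀ (V : Type*) [Fintype V] (G : SimpleGraph V) (n q t : ℕ),
      Fintype.card V = n → N ≤ n →
      IsRounding q (ε ^ 4 * n / (10 ^ 5 * k ^ 2 * Real.log n)) →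
      IsRounding t (ε ^ 7 * n / (10 ^ 11 * k ^ 5)) →
      IsIncomparabilityGraph G →
      (SimpleGraph.completeEquipartiteGraph k q).Free G →
      ∃ (m : ℕ) (W : Fin (m + 1) → Finset V),
        (∀ v : V, ∃! i, v ∈ W i) ∧
        ((W 0).card : ℝ) ≤ ε * n ∧
        (∀ i, i ≠ 0 → (W i).card = t) ∧
        (Set.ncard {p : Fin (m + 1) × Fin (m + 1) |
          0 < p.1 ∧ p.1 < p.2 ∧ ¬ IsHomogeneousPair G (W p.1) (W p.2)} : ℝ) ≤ ε * m ^ 2 := by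
  classical
  obtain ⟨N, hN⟩ := exists_forall_one_le_part_sizes k hk ε hε0
  refine ⟨N, fun V _ G n q t _ hn hq ht ⟨P, hG⟩ hfree => ?_⟩
  obtain ⟨hlog, hq1, ht1⟩ := hN n hn
  obtain ⟨hq0, hq⟩ := hq.bounds hq1
  obtain ⟨ht0, ht⟩ := ht.bounds ht1
  obtain ⟨J, g, hJ, hg, hgt, hbound⟩ := exists_chain_length_mul_bound_le hk hε0 hε1 hlog hq0 hq ht
  have hL0 : 0 < ⌈4 / ε⌉₊ := Nat.ceil_pos.2 (by positivity)
  have hL : 4 ≤ ε * (⌈4 / ε⌉₊ : ℝ) := by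
    have := Nat.le_ceil (4 / ε)
    rw [div_le_iff₀ hε0] at this
    linarith
  generalize ⌈4 / ε⌉₊ = L at hL0 hL hbound
  obtain ⟨K, z, B, R, hz, hB, hBB, hRB, -, hcover, hR⟩ := exists_chains_of_blocks hL0 ht0
    (univ : Finset V)
    (fun T _ hT => exists_le_card_intervalIn hG (by omega) hq0 hfree hJ hg hgt hT)
  let e : Fin (K * L) ≃ Fin K × Fin L := finProdFinEquiv.symm
  refine ⟨K * L, Fin.cons R fun i => B (e i), ?_, ?_, ?_, ?_⟩
  · have hdisj : ∀ i j, i ≠ j →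
        Disjoint ((Fin.cons R fun i => B (e i) : Fin (K * L + 1) → Finset V) i)
          ((Fin.cons R fun i => B (e i) : Fin (K * L + 1) → Finset V) j) := by
      intro i j
      refine Fin.cases ?_ (fun i => ?_) i <;> refine Fin.cases ?_ (fun j => ?_) j
      · exact fun h => absurd rfl h
      · exact fun _ => hRB _
      · exact fun _ => (hRB _).symm
      · exact fun h => hBB _ _ fun he => h (congrArg Fin.succ (e.injective he))
    intro v
    refine existsUnique_of_exists_of_unique ?_ fun i j hi hj => ?_
    · rcases hcover v (mem_univ v) with h | ⟨p, hp⟩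
      · exact ⟨0, h⟩
      · exact ⟨(e.symm p).succ, by simpa using hp⟩
    · by_contra hij
      exact disjoint_left.1 (hdisj i j hij) hi hj
  · exact le_trans (by exact_mod_cast hR) hbound
  · intro i
    refine Fin.cases (fun h => absurd rfl h) (fun i _ => ?_) i
    exact (hB (e i)).1
  · have hcount := card_not_isHomogeneousPair_le hG z hz B fun p => (hB p).2.2
    set S : Finset ((Fin K × Fin L) × (Fin K × Fin L)) :=
      {p | ¬ IsHomogeneousPair G (B p.1) (B p.2)}
    have hsub : {p : Fin (K * L + 1) × Fin (K * L + 1) | 0 < p.1 ∧ p.1 < p.2 ∧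
        ¬ IsHomogeneousPair G ((Fin.cons R fun i => B (e i) : Fin (K * L + 1) → Finset V) p.1)
          ((Fin.cons R fun i => B (e i) : Fin (K * L + 1) → Finset V) p.2)} ⊆
        (S.image fun p => ((e.symm p.1).succ, (e.symm p.2).succ) : Set _) := by
      rintro ⟨i, j⟩ ⟨hi, hij, hom⟩
      obtain ⟨i, rfl⟩ := Fin.exists_succ_eq.2 hi.ne'
      obtain ⟨j, rfl⟩ := Fin.exists_succ_eq.2 (hi.trans hij).ne'
      exact mem_coe.2 (mem_image.2 ⟨(e i, e j), mem_filter.2 ⟨mem_univ _, hom⟩, by simp⟩)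
    have h1 := (Set.ncard_le_ncard hsub (finite_toSet _)).trans
      ((Set.ncard_coe_finset _).le.trans (card_image_le.trans hcount))
    -- Each ordered pair of chains contributes at most 4L, and 4 ≤ εL.
    calc (_ : ℝ) ≤ ((K * K * (4 * L) : ℕ) : ℝ) := by exact_mod_cast h1
      _ = K * K * L * 4 := by push_cast; ring
      _ ≤ K * K * L * (ε * L) := by gcongr
      _ = ε * ((K * L : ℕ) : ℝ) ^ 2 := by push_cast; ring
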